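/- For an integer $n\ge 2$ and $c\in\mathbb C$ let $P_{n,c}(z)=z^n+c$. Let $K(P_{n,c})$ be the filled Julia set, that is, the set of all $z\in\mathbb C$ whose forward orbit under $P_{n,c}$ is bounded, and let the Julia set $J(P_{n,c})=\partial K(P_{n,c})$ be its boundary in $\mathbb C$. Let $\theta\in\mathbb R$ and $c=e^{2\pi i\theta}$. Then for every $\epsilon>0$ there is an $N\ge 2$ such that for every integer $n\ge N$ the following hold: 1. if $\cos(2\pi\theta(n-1))<-\frac12-\frac{\epsilon}{2}$, then $K(P_{n,c})$ is connected; 2. if $\cos(2\pi\theta(n-1))>-\frac12+\frac{\epsilon}{2}$, then $K(P_{n,c})$ is totally disconnected and $K(P_{n,c})=J(P_{n,c})$. -/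

import Mathlib

/-- The unicritical polynomial `P_{n,c}(z) = z ^ n + c` on the complex plane. -/
def unicriticalMap (n : ℕ) (c : ℂ) (z : ℂ) : ℂ := z ^ n + c

/-- The filled Julia set of `f : ℂ → ℂ`: the points whose forward orbit
`z, f z, f (f z), …` is bounded. -/
def filledJuliaSet (f : ℂ → ℂ) : Set ℂ :=
  {z | Bornology.IsBounded (Set.range fun k : ℕ => f^[k] z)}

/-- The Julia set of `f : ℂ → ℂ` (used for polynomials): the topological boundary in `ℂ` of the
filled Julia set. -/
def juliaSet (f : ℂ → ℂ) : Set ℂ := frontier (filledJuliaSet f)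

/-!
For large `n` the fate of the critical orbit `0, c, c ^ n + c, …` is decided by its third term.
If `z ^ n` is small compared with `1 / n`, then the second iterate of `z` is close to `c ^ n + c`,
the second iterate of the critical point. So if `‖c ^ n + c‖ < 1`, a disc around `0` of radius less
than `1` is mapped into itself by the second iterate; the critical orbit is bounded, and pulling a
large disc back along the map, whose only critical value then stays covered, gives a decreasing
sequence of continua with intersection `K`.

If `‖c ^ n + c‖ > 1`, the critical orbit escapes, and so do all points with small `n * ‖z‖ ^ n`.
A point that survives has either derivative at least `2`, or an image close to `c` at which the
derivative is so large that the two steps together expand by at least `4`. Hence the inverse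
branches of the iterates contract exponentially, and connected subsets of `K` are points.
-/

open Filter Function Set Topology

section Topology

variable {X Y : Type*} [TopologicalSpace X] [TopologicalSpace Y]

theorem isPreconnected_iInter_of_antitone [T2Space X] {A : ℕ → Set X} (hA : Antitone A)
    (hcomp : ∀ k, IsCompact (A k)) (hconn : ∀ k, IsPreconnected (A k)) :
    IsPreconnected (⋂ k, A k) := by
  have hK : IsCompact (⋂ k, A k) := (hcomp 0).of_isClosed_subset
    (isClosed_iInter fun k => (hcomp k).isClosed) (iInter_subset _ 0)
  rw [isPreconnected_iff_subset_of_fully_disjoint_closed hK.isClosed]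
  intro u v hu hv huv hdisj
  obtain ⟨U, V, hU, hV, huU, hvV, hUV⟩ : SeparatedNhds ((⋂ k, A k) ∩ u) ((⋂ k, A k) ∩ v) :=
    .of_isCompact_isCompact (hK.inter_right hu) (hK.inter_right hv)
      (hdisj.mono inter_subset_right inter_subset_right)
  have hsub : ⋂ k, A k ⊆ U ∪ V := fun x hx =>
    (huv hx).imp (fun hxu => huU ⟨hx, hxu⟩) (fun hxv => hvV ⟨hx, hxv⟩)
  obtain ⟨k, hk⟩ : ∃ k, A k ⊆ U ∪ V :=
    exists_subset_nhds_of_isCompact' hA.directed_ge hcomp (fun k => (hcomp k).isClosed)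
      fun x hx => (hU.union hV).mem_nhds (hsub hx)
  refine (isPreconnected_iff_subset_of_disjoint.1 (hconn k) U V hU hV hk
    (by rw [hUV.inter_eq, inter_empty])).imp (fun hAU x hx => ?_) (fun hAV x hx => ?_)
  · exact (huv hx).resolve_right fun hxv =>
      disjoint_left.1 hUV (hAU (mem_iInter.1 hx k)) (hvV ⟨hx, hxv⟩)
  · exact (huv hx).resolve_left fun hxu =>
      disjoint_left.1 hUV (huU ⟨hx, hxu⟩) (hAV (mem_iInter.1 hx k))

theorem isPreconnected_preimage_of_fiber_eq_singleton {p : X → Y} (hopen : IsOpenMap p)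
    (hclosed : IsClosedMap p) {A : Set Y} (hA : IsPreconnected A) {x₀ : X} (hx₀ : p x₀ ∈ A)
    (hfiber : ∀ x, p x = p x₀ → x = x₀) : IsPreconnected (p ⁻¹' A) := by
  have subset_of_mem : ∀ u v : Set X, IsOpen u → IsOpen v → p ⁻¹' A ⊆ u ∪ v →
      p ⁻¹' A ∩ (u ∩ v) = ∅ → x₀ ∈ u → p ⁻¹' A ⊆ u := by
    intro u v hu hv huv hdisj hx₀u x hx
    by_contra hxu
    -- The open sets `p '' v` and `(p '' uᶜ)ᶜ` would separate `A`; the second contains `p x₀`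
    -- because `x₀` is the whole fibre.
    have hcover : A ⊆ p '' v ∪ (p '' uᶜ)ᶜ := by
      intro y hy
      refine or_iff_not_imp_right.2 fun hyu => ?_
      obtain ⟨z, hzu, rfl⟩ := not_not.1 hyu
      exact ⟨z, (huv (mem_preimage.2 hy)).resolve_left hzu, rfl⟩
    have hx₀fiber : p x₀ ∉ p '' uᶜ := by
      rintro ⟨z, hzu, hz⟩
      exact hzu (hfiber z hz ▸ hx₀u)
    obtain ⟨_, hpz, ⟨z, hzv, rfl⟩, hzu⟩ := hA _ _ (hopen v hv)
      (hclosed _ hu.isClosed_compl).isOpen_compl hcover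
      ⟨p x, hx, x, (huv hx).resolve_left hxu, rfl⟩ ⟨p x₀, hx₀, hx₀fiber⟩
    have hz : z ∈ u := not_not.1 fun hz => hzu ⟨z, hz, rfl⟩
    exact notMem_empty z (hdisj ▸ ⟨hpz, hz, hzv⟩)
  rw [isPreconnected_iff_subset_of_disjoint]
  intro u v hu hv huv hdisj
  rcases huv hx₀ with hx₀u | hx₀v
  · exact .inl (subset_of_mem u v hu hv huv hdisj hx₀u)
  · exact .inr (subset_of_mem v u hv hu (by rwa [union_comm]) (by rwa [inter_comm v u]) hx₀v)

theorem interior_eq_empty_of_isTotallyDisconnected [LocallyConnectedSpace X]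
    [∀ x : X, (𝓝[≠] x).NeBot] {s : Set X} (hs : IsTotallyDisconnected s) : interior s = ∅ := by
  refine eq_empty_of_forall_notMem fun x hx => ?_
  have hsub : (connectedComponentIn (interior s) x).Subsingleton :=
    hs _ ((connectedComponentIn_subset _ _).trans interior_subset)
      isPreconnected_connectedComponentIn
  have hopen : IsOpen (connectedComponentIn (interior s) x) :=
    isOpen_interior.connectedComponentIn
  rw [hsub.eq_singleton_of_mem (mem_connectedComponentIn hx)] at hopen
  exact not_isOpen_singleton x hopen

theorem exists_eqOn_const_of_pow_eq {K : Type*} [Field K] [IsAlgClosed K] [TopologicalSpace K]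
    [T1Space K] {S : Set X} (hS : IsPreconnected S) {q : X → K} (hq : ContinuousOn q S) {n : ℕ}
    (hn : n ≠ 0) {w : K} (hpow : ∀ x ∈ S, q x ^ n = w) : ∃ ρ, ρ ^ n = w ∧ EqOn q (const X ρ) S := by
  refine hS.eqOn_const_of_mapsTo (T := {ρ : K | ρ ^ n = w}) ?_ hq hpow
    (IsAlgClosed.exists_pow_nat_eq w (Nat.pos_of_ne_zero hn))
  refine Set.Finite.isDiscrete ((Polynomial.nthRootsFinset n w).finite_toSet.subset fun ρ hρ => ?_)
  exact (Polynomial.mem_nthRootsFinset (Nat.pos_of_ne_zero hn) _).2 hρ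

end Topology

section Analysis

theorem deriv_mul_deriv_of_rightInverse {𝕜 : Type*} [NontriviallyNormedField 𝕜] {F G : 𝕜 → 𝕜}
    (hFG : RightInverse G F) {w : 𝕜} (hF : DifferentiableAt 𝕜 F (G w))
    (hG : DifferentiableAt 𝕜 G w) : deriv F (G w) * deriv G w = 1 := by
  rw [← deriv_comp w hF hG, hFG.comp_eq_id, deriv_id]

theorem norm_add_pow_sub_pow_le {A : Type*} [SeminormedRing A] [NormOneClass A] {a : A} {ρ : ℝ}
    (hρ : 1 ≤ ρ) (ha : ‖a‖ ≤ ρ) (δ : A) (n : ℕ) :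
    ‖(a + δ) ^ n - a ^ n‖ ≤ ρ ^ n * ((1 + ‖δ‖) ^ n - 1) := by
  induction n with
  | zero => simp
  | succ n ih =>
    have hbase : ‖a + δ‖ ≤ ρ * (1 + ‖δ‖) := by
      nlinarith [norm_add_le a δ, norm_nonneg δ]
    have hpow : ‖a ^ n‖ ≤ ρ ^ n := (norm_pow_le a n).trans (by gcongr)
    calc ‖(a + δ) ^ (n + 1) - a ^ (n + 1)‖
        = ‖(a + δ) * ((a + δ) ^ n - a ^ n) + δ * a ^ n‖ := by
          rw [pow_succ', pow_succ', mul_sub, add_mul a δ (a ^ n)]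
          abel_nf
      _ ≤ ‖a + δ‖ * ‖(a + δ) ^ n - a ^ n‖ + ‖δ‖ * ‖a ^ n‖ :=
          (norm_add_le _ _).trans (add_le_add (norm_mul_le _ _) (norm_mul_le _ _))
      _ ≤ ρ * (1 + ‖δ‖) * (ρ ^ n * ((1 + ‖δ‖) ^ n - 1)) + ‖δ‖ * (ρ * ρ ^ n) := by
          gcongr
          exact hpow.trans (le_mul_of_one_le_left (by positivity) hρ)
      _ = ρ ^ (n + 1) * ((1 + ‖δ‖) ^ (n + 1) - 1) := by ring

theorem one_sub_div_mem_slitPlane_of_starConvex {s : Set ℂ} (hs : StarConvex ℝ 0 s) {c v : ℂ}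
    (hc : c ∉ s) (hv : v ∈ s) : 1 - v / c ∈ Complex.slitPlane := by
  by_contra hslit
  have hc0 : c ≠ 0 := fun h => hc (h ▸ hs.mem ⟨v, hv⟩)
  obtain ⟨t, ht, hvt⟩ : ∃ t : ℝ, 1 ≤ t ∧ v / c = t := by
    rw [Complex.mem_slitPlane_iff, not_or, not_lt, not_not] at hslit
    refine ⟨(v / c).re, by simpa using hslit.1, Complex.ext rfl ?_⟩
    simpa using hslit.2
  have hcv : c = t⁻¹ • v := by
    rw [eq_inv_smul_iff₀ (by positivity), ← div_mul_cancel₀ v hc0, hvt, Complex.real_smul]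
  exact hc (hcv ▸ starConvex_zero_iff.1 hs hv (by positivity) (inv_le_one_of_one_le₀ ht))

end Analysis

section Escape

variable {f : ℂ → ℂ} {R : ℝ}

/-- `R` is an escape radius of `f`: outside the closed disc of radius `R`, the map at least doubles
the norm. -/
structure IsEscapeRadius (f : ℂ → ℂ) (R : ℝ) : Prop where
  pos : 0 < R
  two_mul_norm_le : ∀ z, R < ‖z‖ → 2 * ‖z‖ ≤ ‖f z‖

/-- The points whose `k`-th iterate lies in the closed disc of radius `R`. If `R` is an escape
radius, these are the points whose first `k` iterates stay in that disc. -/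
def sublevelSet (f : ℂ → ℂ) (R : ℝ) (k : ℕ) : Set ℂ :=
  f^[k] ⁻¹' Metric.closedBall 0 R

theorem mem_sublevelSet {k : ℕ} {z : ℂ} : z ∈ sublevelSet f R k ↔ ‖f^[k] z‖ ≤ R := by
  simp [sublevelSet]

theorem iterate_mem_sublevelSet {j k : ℕ} {z : ℂ} :
    f^[k] z ∈ sublevelSet f R j ↔ z ∈ sublevelSet f R (j + k) := by
  rw [mem_sublevelSet, mem_sublevelSet, iterate_add_apply]

theorem isClosed_sublevelSet (hf : Continuous f) (k : ℕ) : IsClosed (sublevelSet f R k) :=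
  Metric.isClosed_closedBall.preimage (hf.iterate k)

theorem mem_filledJuliaSet {z : ℂ} :
    z ∈ filledJuliaSet f ↔ Bornology.IsBounded (range fun k : ℕ => f^[k] z) :=
  Iff.rfl

theorem mapsTo_filledJuliaSet (f : ℂ → ℂ) :
    MapsTo f (filledJuliaSet f) (filledJuliaSet f) := fun _ hz =>
  (mem_filledJuliaSet.1 hz).subset (range_subset_iff.2 fun k => ⟨k + 1, rfl⟩)

namespace IsEscapeRadius

theorem two_pow_mul_norm_le (hR : IsEscapeRadius f R) {z : ℂ} (hz : R < ‖z‖) (k : ℕ) :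
    2 ^ k * ‖z‖ ≤ ‖f^[k] z‖ := by
  induction k generalizing z with
  | zero => simp
  | succ k ih =>
    have hfz : 2 * ‖z‖ ≤ ‖f z‖ := hR.two_mul_norm_le z hz
    calc 2 ^ (k + 1) * ‖z‖ = 2 ^ k * (2 * ‖z‖) := by ring
      _ ≤ 2 ^ k * ‖f z‖ := by gcongr
      _ ≤ ‖f^[k] (f z)‖ := ih (by linarith [norm_nonneg z])

theorem antitone_sublevelSet (hR : IsEscapeRadius f R) : Antitone (sublevelSet f R) := by
  refine antitone_nat_of_succ_le fun k z hz => ?_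
  rw [mem_sublevelSet] at hz ⊢
  rw [iterate_succ_apply'] at hz
  by_contra! hk
  linarith [hR.two_mul_norm_le _ hk, hR.pos]

theorem filledJuliaSet_eq_iInter (hR : IsEscapeRadius f R) :
    filledJuliaSet f = ⋂ k, sublevelSet f R k := by
  refine Subset.antisymm (fun z hz => mem_iInter.2 fun k => ?_) fun z hz => ?_
  · rw [mem_sublevelSet]
    by_contra! hk
    obtain ⟨M, hM⟩ := (mem_filledJuliaSet.1 hz).exists_norm_le
    obtain ⟨j, hj⟩ := pow_unbounded_of_one_lt (M / R) (one_lt_two : (1 : ℝ) < 2)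
    have hbound : ‖f^[j + k] z‖ ≤ M := hM _ (mem_range_self _)
    have hescape : 2 ^ j * R ≤ ‖f^[j + k] z‖ := by
      rw [iterate_add_apply]
      exact le_trans (by gcongr) (hR.two_pow_mul_norm_le hk j)
    linarith [(div_lt_iff₀ hR.pos).1 hj]
  · exact Metric.isBounded_closedBall.subset (range_subset_iff.2 fun k => mem_iInter.1 hz k)

theorem mem_filledJuliaSet_of_mapsTo_iterate (hR : IsEscapeRadius f R) {m : ℕ} (hm : 0 < m)
    {s : Set ℂ} (hs : MapsTo f^[m] s s) (hsR : s ⊆ Metric.closedBall 0 R) {z : ℂ} (hz : z ∈ s) :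
    z ∈ filledJuliaSet f := by
  rw [hR.filledJuliaSet_eq_iInter, mem_iInter]
  intro k
  refine hR.antitone_sublevelSet (Nat.le_mul_of_pos_left k hm) ?_
  rw [sublevelSet, mem_preimage, iterate_mul]
  exact hsR (hs.iterate k hz)

theorem isCompact_sublevelSet (hR : IsEscapeRadius f R) (hf : Continuous f) (k : ℕ) :
    IsCompact (sublevelSet f R k) :=
  (isCompact_closedBall (0 : ℂ) R).of_isClosed_subset (isClosed_sublevelSet hf k)
    (hR.antitone_sublevelSet k.zero_le)

theorem isClosed_filledJuliaSet (hR : IsEscapeRadius f R) (hf : Continuous f) :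
    IsClosed (filledJuliaSet f) := by
  rw [hR.filledJuliaSet_eq_iInter]
  exact isClosed_iInter fun k => isClosed_sublevelSet hf k

theorem le_norm_deriv_iterate (hR : IsEscapeRadius f R) (hf : Differentiable ℂ f) {a : ℝ}
    (ha : a ≤ 1) (hone : ∀ z ∈ sublevelSet f R 2, a ≤ ‖deriv f z‖)
    (htwo : ∀ z ∈ sublevelSet f R 2,
      2 ≤ ‖deriv f z‖ ∨ 4 ≤ ‖deriv f (f z)‖ * ‖deriv f z‖) (k : ℕ) :
    ∀ z ∈ sublevelSet f R (k + 1), a / 2 * 2 ^ k ≤ ‖deriv f^[k] z‖ := by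
  have chain (k : ℕ) (z : ℂ) : ‖deriv f^[k + 1] z‖ = ‖deriv f^[k] (f z)‖ * ‖deriv f z‖ := by
    rw [iterate_succ, deriv_comp z (hf.iterate k _) (hf z), norm_mul]
  induction k using Nat.twoStepInduction with
  | zero =>
    intro z _
    rw [iterate_zero, deriv_id, norm_one]
    linarith
  | one =>
    intro z hz
    rw [iterate_one]
    linarith [hone z hz]
  | more k ih ih' =>
    intro z hz
    have hfz : f z ∈ sublevelSet f R (k + 2) := hz
    rcases htwo z (hR.antitone_sublevelSet (by omega) hz) with h2 | h4
    · calc a / 2 * 2 ^ (k + 2) = a / 2 * 2 ^ (k + 1) * 2 := by ring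
        _ ≤ ‖deriv f^[k + 1] (f z)‖ * ‖deriv f z‖ := by gcongr; exact ih' _ hfz
        _ = ‖deriv f^[k + 2] z‖ := (chain _ _).symm
    · calc a / 2 * 2 ^ (k + 2) = a / 2 * 2 ^ k * 4 := by ring
        _ ≤ ‖deriv f^[k] (f (f z))‖ * (‖deriv f (f z)‖ * ‖deriv f z‖) := by
          gcongr
          exact ih _ hfz
        _ = ‖deriv f^[k + 2] z‖ := by rw [chain, chain, mul_assoc]

end IsEscapeRadius

end Escape

namespace unicriticalMap

variable {n : ℕ} {c : ℂ} {R : ℝ}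

theorem differentiable (n : ℕ) (c : ℂ) : Differentiable ℂ (unicriticalMap n c) := by
  unfold unicriticalMap
  fun_prop

theorem norm_deriv (z : ℂ) : ‖deriv (unicriticalMap n c) z‖ = n * ‖z‖ ^ (n - 1) := by
  unfold unicriticalMap
  simp

theorem isOpenMap (hn : n ≠ 0) (c : ℂ) : IsOpenMap (unicriticalMap n c) :=
  have : NeZero n := ⟨hn⟩
  (Homeomorph.addRight c).isOpenMap.comp (Complex.isOpenQuotientMap_pow n).isOpenMap

theorem isClosedMap (n : ℕ) (c : ℂ) : IsClosedMap (unicriticalMap n c) :=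
  (Homeomorph.addRight c).isClosedMap.comp (isClosedMap_pow ℂ n)

theorem isEscapeRadius (hc : ‖c‖ ≤ R) (hR : 3 ≤ R ^ (n - 1)) :
    IsEscapeRadius (unicriticalMap n c) R := by
  have hn : n - 1 ≠ 0 := by
    intro h
    norm_num [h] at hR
  have hpos : 0 < R := by
    refine ((norm_nonneg c).trans hc).lt_of_ne fun h => ?_
    norm_num [← h, hn] at hR
  refine ⟨hpos, fun z hz => ?_⟩
  calc 2 * ‖z‖ ≤ 3 * ‖z‖ - ‖c‖ := by linarith
    _ ≤ ‖z‖ ^ (n - 1) * ‖z‖ - ‖c‖ := by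
      gcongr
      exact hR.trans (by gcongr)
    _ = ‖z ^ n‖ - ‖c‖ := by rw [pow_sub_one_mul (by omega), norm_pow]
    _ ≤ ‖unicriticalMap n c z‖ := norm_sub_le_norm_add _ _

theorem isEscapeRadius_max_three (hn : 2 ≤ n) (c : ℂ) :
    IsEscapeRadius (unicriticalMap n c) (max 3 ‖c‖) := by
  refine isEscapeRadius (le_max_right _ _) ?_
  calc (3 : ℝ) ≤ max 3 ‖c‖ := le_max_left _ _
    _ ≤ max 3 ‖c‖ ^ (n - 1) :=
      le_self_pow₀ (by linarith [le_max_left 3 ‖c‖]) (by omega)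

section Connected

theorem isPreconnected_sublevelSet (hn : n ≠ 0)
    (h0 : ∀ k, (0 : ℂ) ∈ sublevelSet (unicriticalMap n c) R k) (k : ℕ) :
    IsPreconnected (sublevelSet (unicriticalMap n c) R k) := by
  induction k with
  | zero => exact (convex_closedBall (0 : ℂ) R).isPreconnected
  | succ k ih =>
    refine isPreconnected_preimage_of_fiber_eq_singleton (isOpenMap hn c) (isClosedMap n c) ih
      (h0 (k + 1)) fun z hz => ?_
    simpa [unicriticalMap, hn] using hz

theorem isConnected_filledJuliaSet (hn : 2 ≤ n) (h0 : 0 ∈ filledJuliaSet (unicriticalMap n c)) :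
    IsConnected (filledJuliaSet (unicriticalMap n c)) := by
  have hR := isEscapeRadius_max_three hn c
  refine ⟨⟨0, h0⟩, ?_⟩
  rw [hR.filledJuliaSet_eq_iInter] at h0 ⊢
  exact isPreconnected_iInter_of_antitone hR.antitone_sublevelSet
    (hR.isCompact_sublevelSet (differentiable n c).continuous)
    (isPreconnected_sublevelSet (by omega) (mem_iInter.1 h0))

end Connected

section TotallyDisconnected

theorem starConvex_sublevelSet_one (hc : ‖c‖ ≤ R) :
    StarConvex ℝ 0 (sublevelSet (unicriticalMap n c) R 1) := by
  refine starConvex_zero_iff.2 fun z hz t ht₀ ht₁ => ?_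
  rw [mem_sublevelSet, iterate_one, unicriticalMap, ← mem_closedBall_zero_iff] at hz ⊢
  have hconvex : (t • z) ^ n + c = t ^ n • (z ^ n + c) + (1 - t ^ n) • c := by
    rw [smul_pow, smul_add, sub_smul, one_smul]
    ring
  rw [hconvex]
  exact convex_closedBall (0 : ℂ) R hz (mem_closedBall_zero_iff.2 hc) (by positivity)
    (sub_nonneg.2 (pow_le_one₀ ht₀ ht₁)) (add_sub_cancel _ _)

theorem exists_rightInverse (hn : n ≠ 0) (hc : c ≠ 0) {C : Set ℂ} (hC : IsPreconnected C)
    (hslit : ∀ z ∈ C, 1 - unicriticalMap n c z / c ∈ Complex.slitPlane) :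
    ∃ g : ℂ → ℂ, RightInverse g (unicriticalMap n c) ∧
      (∀ w, 1 - w / c ∈ Complex.slitPlane → DifferentiableAt ℂ g w) ∧
      LeftInvOn g (unicriticalMap n c) C := by
  set r : ℂ → ℂ := fun w => (1 - w / c) ^ (n : ℂ)⁻¹
  have hr_pow (w : ℂ) : r w ^ n = 1 - w / c := Complex.cpow_nat_inv_pow _ hn
  have hr_diff (w : ℂ) (hw : 1 - w / c ∈ Complex.slitPlane) : DifferentiableAt ℂ r w :=
    ((differentiableAt_const _).sub (differentiableAt_id.div_const c)).cpow
      (differentiableAt_const _) hw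
  have hr_ne (z : ℂ) (hz : z ∈ C) : r (unicriticalMap n c z) ≠ 0 := fun h =>
    Complex.slitPlane_ne_zero (hslit z hz) (by rw [← hr_pow, h, zero_pow hn])
  have hquot_pow (z : ℂ) (hz : z ∈ C) : (z / r (unicriticalMap n c z)) ^ n = -c := by
    rw [div_pow, hr_pow, div_eq_iff (Complex.slitPlane_ne_zero (hslit z hz)), unicriticalMap]
    field_simp
    ring
  have hquot_cont : ContinuousOn (fun z => z / r (unicriticalMap n c z)) C :=
    continuousOn_id.div (fun z hz => ((hr_diff _ (hslit z hz)).continuousAt.comp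
      (differentiable n c z).continuousAt).continuousWithinAt) hr_ne
  -- On `C` the root `r ∘ f` inverts `f` up to a constant factor, which `g` has to include.
  obtain ⟨ρ, hρ, hquot⟩ := exists_eqOn_const_of_pow_eq hC hquot_cont hn hquot_pow
  refine ⟨fun w => ρ * r w, fun w => ?_, fun w hw => (hr_diff w hw).const_mul ρ, fun z hz => ?_⟩
  · rw [unicriticalMap, mul_pow, hr_pow, hρ]
    field_simp
    ring
  · change ρ * r (unicriticalMap n c z) = z
    exact ((div_eq_iff (hr_ne z hz)).1 (hquot hz)).symm

theorem exists_rightInverse_iterate (hR : IsEscapeRadius (unicriticalMap n c) R) (hn : n ≠ 0)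
    (hcR : ‖c‖ ≤ R) (hcrit : c ∉ sublevelSet (unicriticalMap n c) R 1) (k : ℕ) {C : Set ℂ}
    (hC : IsPreconnected C) (hCK : C ⊆ filledJuliaSet (unicriticalMap n c)) :
    ∃ G : ℂ → ℂ, RightInverse G (unicriticalMap n c)^[k] ∧
      (∀ w ∈ sublevelSet (unicriticalMap n c) R 1, DifferentiableAt ℂ G w) ∧
      LeftInvOn G (unicriticalMap n c)^[k] C := by
  have hstar := starConvex_sublevelSet_one (n := n) hcR
  have hslit (w : ℂ) (hw : w ∈ sublevelSet (unicriticalMap n c) R 1) :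
      1 - w / c ∈ Complex.slitPlane :=
    one_sub_div_mem_slitPlane_of_starConvex hstar hcrit hw
  induction k generalizing C with
  | zero => exact ⟨id, fun _ => rfl, fun _ _ => differentiableAt_id, fun _ _ => rfl⟩
  | succ k ih =>
    have hc : c ≠ 0 := by
      rintro rfl
      exact hcrit (by simp [mem_sublevelSet, unicriticalMap, hn, hR.pos.le])
    obtain ⟨g, hfg, hg, hgf⟩ := exists_rightInverse hn hc hC fun z hz =>
      hslit _ (mem_iInter.1 (hR.filledJuliaSet_eq_iInter ▸ hCK hz) 2)
    obtain ⟨G, hfG, hG, hGf⟩ := ih (hC.image _ (differentiable n c).continuous.continuousOn)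
      ((mapsTo_filledJuliaSet _).mono_left hCK).image_subset
    refine ⟨g ∘ G, fun w => ?_, fun w hw => (hg _ (hslit _ ?_)).comp w (hG w hw), fun z hz => ?_⟩
    · rw [iterate_succ_apply, comp_apply, hfg, hfG]
    · refine hR.antitone_sublevelSet (Nat.le_add_right 1 k) (iterate_mem_sublevelSet.1 ?_)
      rwa [hfG w]
    · rw [iterate_succ_apply, comp_apply, hGf (mem_image_of_mem _ hz), hgf hz]

theorem norm_sub_le_of_isPreconnected (hR : IsEscapeRadius (unicriticalMap n c) R) (hn : n ≠ 0)
    (hcR : ‖c‖ ≤ R) (hcrit : c ∉ sublevelSet (unicriticalMap n c) R 1) {k : ℕ} {m : ℝ} (hm : 0 < m)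
    (hderiv : ∀ z ∈ sublevelSet (unicriticalMap n c) R (k + 1),
      m ≤ ‖deriv (unicriticalMap n c)^[k] z‖)
    {C : Set ℂ} (hC : IsPreconnected C) (hCK : C ⊆ filledJuliaSet (unicriticalMap n c)) {x y : ℂ}
    (hx : x ∈ C) (hy : y ∈ C) : ‖x - y‖ ≤ 2 * R / m := by
  obtain ⟨G, hfG, hG, hGf⟩ := exists_rightInverse_iterate hR hn hcR hcrit k hC hCK
  have hG_deriv (w : ℂ) (hw : w ∈ sublevelSet (unicriticalMap n c) R 1) :
      ‖deriv G w‖ ≤ m⁻¹ := by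
    have hGw : G w ∈ sublevelSet (unicriticalMap n c) R (k + 1) := by
      rw [add_comm, ← iterate_mem_sublevelSet, hfG w]
      exact hw
    have hprod : ‖deriv (unicriticalMap n c)^[k] (G w)‖ * ‖deriv G w‖ = 1 := by
      rw [← norm_mul, deriv_mul_deriv_of_rightInverse hfG ((differentiable n c).iterate k _)
        (hG w hw), norm_one]
    rw [eq_inv_of_mul_eq_one_right hprod]
    exact inv_anti₀ hm (hderiv _ hGw)
  have hball (z : ℂ) (hz : z ∈ C) : ‖z - G 0‖ ≤ m⁻¹ * R := by
    have hlevel (j : ℕ) : z ∈ sublevelSet (unicriticalMap n c) R j :=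
      mem_iInter.1 (hR.filledJuliaSet_eq_iInter ▸ hCK hz) j
    have hseg := (starConvex_sublevelSet_one hcR).segment_subset
      (iterate_mem_sublevelSet.2 (hlevel (1 + k)))
    have hmean := (convex_segment _ _).norm_image_sub_le_of_norm_deriv_le
      (fun w hw => hG w (hseg hw)) (fun w hw => hG_deriv w (hseg hw))
      (left_mem_segment ℝ _ _) (right_mem_segment ℝ _ _)
    rw [hGf hz, sub_zero] at hmean
    exact hmean.trans (by gcongr; exact mem_sublevelSet.1 (hlevel k))
  calc ‖x - y‖ ≤ ‖x - G 0‖ + ‖y - G 0‖ := by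
        simpa [dist_eq_norm] using dist_triangle_right x y (G 0)
    _ ≤ m⁻¹ * R + m⁻¹ * R := add_le_add (hball x hx) (hball y hy)
    _ = 2 * R / m := by ring

theorem isTotallyDisconnected_filledJuliaSet (hR : IsEscapeRadius (unicriticalMap n c) R)
    (hn : n ≠ 0) (hcR : ‖c‖ ≤ R) (hcrit : c ∉ sublevelSet (unicriticalMap n c) R 1) {a : ℝ}
    (ha : 0 < a) (hexp : ∀ k, ∀ z ∈ sublevelSet (unicriticalMap n c) R (k + 1),
      a * 2 ^ k ≤ ‖deriv (unicriticalMap n c)^[k] z‖) :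
    IsTotallyDisconnected (filledJuliaSet (unicriticalMap n c)) := by
  intro C hCK hC x hx y hy
  have hbound (k : ℕ) : ‖x - y‖ ≤ 2 * R / (a * 2 ^ k) :=
    norm_sub_le_of_isPreconnected hR hn hcR hcrit (by positivity) (hexp k) hC hCK hx hy
  have hlim : Tendsto (fun k : ℕ => 2 * R / (a * 2 ^ k)) atTop (𝓝 0) :=
    ((tendsto_pow_atTop_atTop_of_one_lt one_lt_two).const_mul_atTop ha).const_div_atTop _
  exact sub_eq_zero.1 (norm_le_zero_iff.1 (ge_of_tendsto' hlim hbound))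

end TotallyDisconnected

section SecondIterate

theorem norm_map_map_sub_le {ρ τ : ℝ} (hρ : 1 ≤ ρ) (hc : ‖c‖ ≤ ρ) (hτ : τ ≤ 1) {z : ℂ}
    (hz : n * ‖z‖ ^ n ≤ τ) :
    ‖unicriticalMap n c (unicriticalMap n c z) - (c ^ n + c)‖ ≤ ρ ^ n * (2 * τ) := by
  have hτ₀ : 0 ≤ τ := le_trans (by positivity) hz
  have hpow : (1 + ‖z ^ n‖) ^ n - 1 ≤ 2 * τ := by
    have hexp : (1 + ‖z ^ n‖) ^ n ≤ Real.exp τ := calc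
      (1 + ‖z ^ n‖) ^ n ≤ Real.exp ‖z ^ n‖ ^ n := by
        gcongr
        linarith [Real.add_one_le_exp ‖z ^ n‖]
      _ = Real.exp (n * ‖z‖ ^ n) := by rw [← Real.exp_nat_mul, norm_pow]
      _ ≤ Real.exp τ := Real.exp_le_exp.2 hz
    have hsub := Real.abs_exp_sub_one_le (x := τ) (by rwa [abs_of_nonneg hτ₀])
    rw [abs_of_nonneg hτ₀] at hsub
    linarith [le_abs_self (Real.exp τ - 1)]
  calc ‖unicriticalMap n c (unicriticalMap n c z) - (c ^ n + c)‖
      = ‖(c + z ^ n) ^ n - c ^ n‖ := by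
        rw [unicriticalMap, unicriticalMap, add_sub_add_right_eq_sub, add_comm c]
    _ ≤ ρ ^ n * ((1 + ‖z ^ n‖) ^ n - 1) := norm_add_pow_sub_pow_le hρ hc _ n
    _ ≤ ρ ^ n * (2 * τ) := by gcongr

theorem max_one_norm_pow_le_three (hn : 2 ≤ n) (h : ‖c ^ n + c‖ ≤ 1) : max 1 ‖c‖ ^ n ≤ 3 := by
  rcases le_total ‖c‖ 1 with hc | hc
  · norm_num [max_eq_left hc]
  · have hpow : ‖c‖ ^ n ≤ 1 + ‖c‖ := by
      have := norm_sub_le_norm_add (c ^ n) c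
      rw [norm_pow] at this
      linarith
    have hsq : ‖c‖ ^ 2 ≤ ‖c‖ ^ n := by gcongr
    rw [max_eq_right hc]
    nlinarith

theorem max_lt_norm_pow_add_sub {r s : ℝ} (hs : 1 < s) (hsr : s < r) (hsn : 3 ≤ s ^ (n - 1))
    (hc : r ≤ ‖c ^ n + c‖) :
    max s ‖c‖ < ‖c ^ n + c‖ - max 1 ‖c‖ ^ n * (2 * ((r - s) / (6 * r))) := by
  have hr : 0 < r := by linarith
  rcases le_or_gt (3 * max s ‖c‖) (‖c‖ ^ n) with hlarge | hsmall
  · have hone : 1 < max s ‖c‖ := hs.trans_le (le_max_left _ _)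
    have hc₁ : 1 ≤ ‖c‖ := by
      by_contra! h
      linarith [pow_le_one₀ (n := n) (norm_nonneg c) h.le]
    have hτ : (r - s) / (6 * r) < 1 / 6 := by
      rw [div_lt_iff₀ (by positivity)]
      linarith
    have hnorm := norm_sub_le_norm_add (c ^ n) c
    rw [norm_pow] at hnorm
    rw [max_eq_right hc₁]
    nlinarith [le_max_right s ‖c‖]
  · have hn : n ≠ 0 := by
      rintro rfl
      norm_num at hsn
    have hcs : ‖c‖ ≤ s := by
      by_contra! h
      rw [max_eq_right h.le, ← pow_sub_one_mul hn] at hsmall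
      have : s ^ (n - 1) ≤ ‖c‖ ^ (n - 1) := by gcongr
      nlinarith
    rw [max_eq_left hcs] at hsmall ⊢
    have hρ : max 1 ‖c‖ ^ n ≤ 3 * s := by
      rcases max_choice 1 ‖c‖ with h | h <;> rw [h]
      · linarith [one_pow (M := ℝ) n]
      · exact hsmall.le
    calc s < r - s * ((r - s) / r) := by
          rw [lt_sub_comm, mul_div_assoc', div_lt_iff₀ hr]
          nlinarith
      _ = r - 3 * s * (2 * ((r - s) / (6 * r))) := by
          field_simp
          ring
      _ ≤ ‖c ^ n + c‖ - max 1 ‖c‖ ^ n * (2 * ((r - s) / (6 * r))) := by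
          have : 0 ≤ (r - s) / (6 * r) := div_nonneg (by linarith) (by positivity)
          gcongr

theorem max_lt_norm_map_map {r s : ℝ} (hs : 1 < s) (hsr : s < r) (hsn : 3 ≤ s ^ (n - 1))
    (hc : r ≤ ‖c ^ n + c‖) {z : ℂ} (hz : n * ‖z‖ ^ n ≤ (r - s) / (6 * r)) :
    max s ‖c‖ < ‖unicriticalMap n c (unicriticalMap n c z)‖ := by
  have hτ : (r - s) / (6 * r) ≤ 1 := (div_le_one (by linarith)).2 (by linarith)
  have hclose := norm_map_map_sub_le (le_max_left 1 ‖c‖) (le_max_right _ _) hτ hz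
  have hnorm := norm_le_norm_add_norm_sub (unicriticalMap n c (unicriticalMap n c z)) (c ^ n + c)
  linarith [max_lt_norm_pow_add_sub hs hsr hsn hc]

end SecondIterate

theorem eventually_isConnected_filledJuliaSet {r : ℝ} (hr : r < 1) :
    ∀ᶠ n : ℕ in atTop, ∀ c : ℂ, ‖c ^ n + c‖ ≤ r →
      IsConnected (filledJuliaSet (unicriticalMap n c)) := by
  obtain ⟨s, hs, hs₁⟩ := exists_between (max_lt hr one_pos)
  obtain ⟨hrs, hs₀⟩ := max_lt_iff.1 hs
  have hsmall : ∀ᶠ n : ℕ in atTop, n * s ^ n ≤ (s - r) / 6 :=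
    (tendsto_self_mul_const_pow_of_lt_one hs₀.le hs₁).eventually_le_const (by linarith)
  filter_upwards [hsmall, eventually_ge_atTop 2] with n hns hn c hc
  have hr₀ : 0 ≤ r := (norm_nonneg _).trans hc
  have hmaps : MapsTo (unicriticalMap n c)^[2] (Metric.closedBall 0 s)
      (Metric.closedBall 0 s) := by
    intro z hz
    rw [mem_closedBall_zero_iff] at hz ⊢
    have hclose := norm_map_map_sub_le (le_max_left 1 ‖c‖) (le_max_right _ _)
      (by linarith) ((by gcongr : n * ‖z‖ ^ n ≤ n * s ^ n).trans hns)
    have hnorm := norm_le_norm_add_norm_sub' ((unicriticalMap n c)^[2] z) (c ^ n + c)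
    calc ‖(unicriticalMap n c)^[2] z‖
        ≤ ‖c ^ n + c‖ + max 1 ‖c‖ ^ n * (2 * ((s - r) / 6)) := hnorm.trans (by gcongr; exact hclose)
      _ ≤ r + 3 * (2 * ((s - r) / 6)) := by
          have hρ := max_one_norm_pow_le_three hn (hc.trans hr.le)
          have : 0 ≤ (s - r) / 6 := by linarith
          gcongr
      _ = s := by ring
  refine isConnected_filledJuliaSet hn ?_
  refine (isEscapeRadius_max_three hn c).mem_filledJuliaSet_of_mapsTo_iterate two_pos hmaps
    (Metric.closedBall_subset_closedBall ?_) (Metric.mem_closedBall_self hs₀.le)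
  linarith [le_max_left 3 ‖c‖]

section Expansion

theorem mul_norm_pow_lt_of_norm_deriv_lt {t : ℝ} (ht : t ≤ n) {z : ℂ}
    (h : ‖deriv (unicriticalMap n c) z‖ < t) : n * ‖z‖ ^ n < t := by
  rw [norm_deriv] at h
  have hn : 0 < (n : ℝ) := (lt_of_le_of_lt (by positivity) h).trans_le ht
  have hz : ‖z‖ < 1 := by
    by_contra! hz
    nlinarith [one_le_pow₀ (n := n - 1) hz]
  refine lt_of_le_of_lt ?_ h
  gcongr n * ?_
  exact pow_le_pow_of_le_one (norm_nonneg z) hz.le (Nat.sub_le n 1)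

theorem half_le_norm_of_one_le_norm_pow_add (hn : n ≠ 0) (h : 1 ≤ ‖c ^ n + c‖) : 1 / 2 ≤ ‖c‖ := by
  by_contra! hc
  have hpow : ‖c‖ ^ n ≤ ‖c‖ := pow_le_of_le_one (norm_nonneg c) (by linarith) hn
  have hsum := norm_add_le (c ^ n) c
  rw [norm_pow] at hsum
  linarith

theorem min_one_sub_one_le_norm_pow {r : ℝ} (h : r ≤ ‖c ^ n + c‖) :
    min 1 (r - 1) ≤ ‖c‖ ^ n := by
  rcases le_total 1 ‖c‖ with hc | hc
  · exact (min_le_left _ _).trans (one_le_pow₀ hc)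
  · have hsum := norm_add_le (c ^ n) c
    rw [norm_pow] at hsum
    exact (min_le_right _ _).trans (by linarith)

theorem norm_pow_le_exp_mul_norm_map_pow (hn : 8 ≤ n) (hc : 1 / 2 ≤ ‖c‖) {z : ℂ}
    (hz : n * ‖z‖ ^ n ≤ 2) : ‖c‖ ^ n ≤ Real.exp 8 * ‖unicriticalMap n c z‖ ^ n := by
  have hn' : (8 : ℝ) ≤ n := by exact_mod_cast hn
  have hzn : ‖z‖ ^ n ≤ 2 / n := by
    rw [le_div_iff₀ (by positivity)]
    linarith
  have hdist : ‖c‖ - ‖unicriticalMap n c z‖ ≤ 2 / n := by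
    have := norm_sub_le_norm_add c (z ^ n)
    rw [norm_pow, add_comm c] at this
    exact le_trans (by rw [unicriticalMap]; linarith) hzn
  have hquarter : 1 / 4 ≤ ‖unicriticalMap n c z‖ := by
    have : 2 / (n : ℝ) ≤ 2 / 8 := by gcongr
    linarith
  have hbase : ‖c‖ ≤ Real.exp (8 / n) * ‖unicriticalMap n c z‖ := calc
    ‖c‖ ≤ 8 / n * (1 / 4) + ‖unicriticalMap n c z‖ := by
      linarith [show 8 / (n : ℝ) * (1 / 4) = 2 / n by ring]
    _ ≤ 8 / n * ‖unicriticalMap n c z‖ + ‖unicriticalMap n c z‖ := by gcongr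
    _ = (8 / n + 1) * ‖unicriticalMap n c z‖ := by ring
    _ ≤ Real.exp (8 / n) * ‖unicriticalMap n c z‖ := by
      gcongr
      exact Real.add_one_le_exp _
  calc ‖c‖ ^ n ≤ (Real.exp (8 / n) * ‖unicriticalMap n c z‖) ^ n := by gcongr
    _ = Real.exp 8 * ‖unicriticalMap n c z‖ ^ n := by
      rw [mul_pow, ← Real.exp_nat_mul, mul_div_cancel₀ _ (by positivity)]

theorem le_norm_deriv_map (hn : 8 ≤ n) (hc : 1 / 2 ≤ ‖c‖) {B : ℝ} (hB : B ≤ n)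
    (hBc : B * Real.exp 8 ≤ n * ‖c‖ ^ n) {z : ℂ} (hz : ‖deriv (unicriticalMap n c) z‖ < 2) :
    B ≤ ‖deriv (unicriticalMap n c) (unicriticalMap n c z)‖ := by
  by_contra! h
  have hn' : (2 : ℝ) ≤ n := by exact_mod_cast (by omega : 2 ≤ n)
  have hpow := norm_pow_le_exp_mul_norm_map_pow hn hc (mul_norm_pow_lt_of_norm_deriv_lt hn' hz).le
  have hlt := mul_norm_pow_lt_of_norm_deriv_lt hB h
  refine lt_irrefl (B * Real.exp 8) ?_
  calc B * Real.exp 8 ≤ n * ‖c‖ ^ n := hBc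
    _ ≤ n * (Real.exp 8 * ‖unicriticalMap n c z‖ ^ n) := by gcongr
    _ = n * ‖unicriticalMap n c z‖ ^ n * Real.exp 8 := by ring
    _ < B * Real.exp 8 := by gcongr

end Expansion

theorem isTotallyDisconnected_filledJuliaSet_of_le_norm_pow_add {r s : ℝ} (hs : 1 < s) (hsr : s < r)
    (hsn : 3 ≤ s ^ (n - 1)) (hn : 8 ≤ n)
    (hnr : 4 / ((r - s) / (6 * r)) * Real.exp 8 ≤ n * min 1 (r - 1)) (hc : r ≤ ‖c ^ n + c‖) :
    IsTotallyDisconnected (filledJuliaSet (unicriticalMap n c)) := by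
  have hr : 0 < r := by linarith
  have hn₀ : n ≠ 0 := by omega
  set τ : ℝ := (r - s) / (6 * r)
  have hτ₀ : 0 < τ := div_pos (by linarith) (by positivity)
  have hτ₁ : τ ≤ 1 := (div_le_one (by positivity)).2 (by linarith)
  have hR : IsEscapeRadius (unicriticalMap n c) (max s ‖c‖) :=
    isEscapeRadius (le_max_right _ _) (hsn.trans (by gcongr; exact le_max_left _ _))
  have hcrit : c ∉ sublevelSet (unicriticalMap n c) (max s ‖c‖) 1 := by
    have hescape := max_lt_norm_map_map hs hsr hsn hc (z := 0) (by simpa [hn₀] using hτ₀.le)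
    rw [mem_sublevelSet, iterate_one, not_le]
    simpa [unicriticalMap, hn₀] using hescape
  have hone (z : ℂ) (hz : z ∈ sublevelSet (unicriticalMap n c) (max s ‖c‖) 2) :
      τ ≤ ‖deriv (unicriticalMap n c) z‖ := by
    by_contra! h
    have hτn : τ ≤ n := hτ₁.trans (by exact_mod_cast Nat.one_le_iff_ne_zero.2 hn₀)
    exact (max_lt_norm_map_map hs hsr hsn hc
      (mul_norm_pow_lt_of_norm_deriv_lt hτn h).le).not_ge (mem_sublevelSet.1 hz)
  have hBn : 4 / τ ≤ n := calc
    4 / τ ≤ 4 / τ * Real.exp 8 := le_mul_of_one_le_right (by positivity) (by simp)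
    _ ≤ n * min 1 (r - 1) := hnr
    _ ≤ n := mul_le_of_le_one_right (by positivity) (min_le_left _ _)
  have hBc : 4 / τ * Real.exp 8 ≤ n * ‖c‖ ^ n :=
    hnr.trans (by gcongr; exact min_one_sub_one_le_norm_pow hc)
  have hhalf : 1 / 2 ≤ ‖c‖ := half_le_norm_of_one_le_norm_pow_add hn₀ (by linarith)
  refine isTotallyDisconnected_filledJuliaSet hR hn₀ (le_max_right _ _) hcrit (half_pos hτ₀)
    (hR.le_norm_deriv_iterate (differentiable n c) hτ₁ hone fun z hz => ?_)
  refine or_iff_not_imp_left.2 fun h2 => ?_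
  calc (4 : ℝ) = 4 / τ * τ := (div_mul_cancel₀ _ hτ₀.ne').symm
    _ ≤ ‖deriv (unicriticalMap n c) (unicriticalMap n c z)‖ * ‖deriv (unicriticalMap n c) z‖ :=
      mul_le_mul (le_norm_deriv_map hn hhalf hBn hBc (not_le.1 h2)) (hone z hz) hτ₀.le
        (norm_nonneg _)

theorem eventually_isTotallyDisconnected_filledJuliaSet {r : ℝ} (hr : 1 < r) :
    ∀ᶠ n : ℕ in atTop, ∀ c : ℂ, r ≤ ‖c ^ n + c‖ →
      IsTotallyDisconnected (filledJuliaSet (unicriticalMap n c)) := by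
  obtain ⟨s, hs, hsr⟩ := exists_between hr
  have hescape : ∀ᶠ n : ℕ in atTop, 3 ≤ s ^ (n - 1) :=
    ((tendsto_pow_atTop_atTop_of_one_lt hs).comp
      (tendsto_sub_atTop_nat 1)).eventually_ge_atTop 3
  have hlarge : ∀ᶠ n : ℕ in atTop,
      4 / ((r - s) / (6 * r)) * Real.exp 8 ≤ n * min 1 (r - 1) :=
    (tendsto_natCast_atTop_atTop.atTop_mul_const
      (lt_min one_pos (by linarith))).eventually_ge_atTop _
  filter_upwards [hescape, hlarge, eventually_ge_atTop 8] with n hsn hnr hn c hc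
  exact isTotallyDisconnected_filledJuliaSet_of_le_norm_pow_add hs hsr hsn hn hnr hc

theorem filledJuliaSet_eq_juliaSet (hn : 2 ≤ n)
    (h : IsTotallyDisconnected (filledJuliaSet (unicriticalMap n c))) :
    filledJuliaSet (unicriticalMap n c) = juliaSet (unicriticalMap n c) := by
  have hclosed := (isEscapeRadius_max_three hn c).isClosed_filledJuliaSet
    (differentiable n c).continuous
  rw [juliaSet, hclosed.frontier_eq, interior_eq_empty_of_isTotallyDisconnected h, sdiff_empty]

end unicriticalMap

theorem norm_exp_mul_I_add_exp_mul_I_sq (x y : ℝ) :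
    ‖Complex.exp (x * Complex.I) + Complex.exp (y * Complex.I)‖ ^ 2 = 2 + 2 * Real.cos (x - y) := by
  rw [← Complex.normSq_eq_norm_sq, Complex.normSq_apply, Complex.add_re, Complex.add_im,
    Complex.exp_ofReal_mul_I_re, Complex.exp_ofReal_mul_I_re, Complex.exp_ofReal_mul_I_im,
    Complex.exp_ofReal_mul_I_im, Real.cos_sub]
  linarith [Real.sin_sq_add_cos_sq x, Real.sin_sq_add_cos_sq y]

theorem norm_exp_mul_I_pow_add_sq (x : ℝ) (n : ℕ) :
    ‖Complex.exp (x * Complex.I) ^ n + Complex.exp (x * Complex.I)‖ ^ 2 =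
      2 + 2 * Real.cos (x * (n - 1)) := by
  have hpow : Complex.exp (x * Complex.I) ^ n = Complex.exp ((n * x : ℝ) * Complex.I) := by
    rw [← Complex.exp_nat_mul, Complex.ofReal_mul, Complex.ofReal_natCast, mul_assoc]
  rw [hpow, norm_exp_mul_I_add_exp_mul_I_sq, mul_sub_one, mul_comm x]

theorem corollary3p2_general {ε : ℝ} (hε : 0 < ε) : ∃ N : ℕ, 2 ≤ N ∧ ∀ n : ℕ, N ≤ n → ∀ c : ℂ,
    (‖c ^ n + c‖ ^ 2 < 1 - ε → IsConnected (filledJuliaSet (unicriticalMap n c))) ∧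
    (1 + ε < ‖c ^ n + c‖ ^ 2 →
      IsTotallyDisconnected (filledJuliaSet (unicriticalMap n c)) ∧
      filledJuliaSet (unicriticalMap n c) = juliaSet (unicriticalMap n c)) := by
  have hlt : √(1 - ε) < 1 := (Real.sqrt_lt' one_pos).2 (by linarith)
  have hgt : 1 < √(1 + ε) := Real.lt_sqrt_of_sq_lt (by linarith)
  obtain ⟨N, hN⟩ := eventually_atTop.1
    ((unicriticalMap.eventually_isConnected_filledJuliaSet hlt).and
      (unicriticalMap.eventually_isTotallyDisconnected_filledJuliaSet hgt))
  refine ⟨max N 2, le_max_right _ _, fun n hn c => ⟨fun hc => ?_, fun hc => ?_⟩⟩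
  · exact (hN n (le_of_max_le_left hn)).1 c (Real.le_sqrt_of_sq_le hc.le)
  · have htd := (hN n (le_of_max_le_left hn)).2 c (Real.sqrt_le_left (norm_nonneg _) |>.2 hc.le)
    exact ⟨htd, unicriticalMap.filledJuliaSet_eq_juliaSet (le_of_max_le_right hn) htd⟩

theorem corollary3p2 (θ : ℝ) (c : ℂ) (hc : c = Complex.exp (2 * Real.pi * Complex.I * θ)) :
    ∀ ε : ℝ, 0 < ε → ∃ N : ℕ, 2 ≤ N ∧ ∀ n : ℕ, N ≤ n →
      (Real.cos (2 * Real.pi * θ * ((n : ℝ) - 1)) < -1 / 2 - ε / 2 →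
        IsConnected (filledJuliaSet (unicriticalMap n c))) ∧
      (-1 / 2 + ε / 2 < Real.cos (2 * Real.pi * θ * ((n : ℝ) - 1)) →
        IsTotallyDisconnected (filledJuliaSet (unicriticalMap n c)) ∧
        filledJuliaSet (unicriticalMap n c) = juliaSet (unicriticalMap n c)) := by
  intro ε hε
  obtain ⟨N, hN₂, hN⟩ := corollary3p2_general hε
  have hc' : c = Complex.exp ((2 * Real.pi * θ : ℝ) * Complex.I) := by
    rw [hc]
    push_cast
    ring_nf
  refine ⟨N, hN₂, fun n hn => ?_⟩
  have hsq := norm_exp_mul_I_pow_add_sq (2 * Real.pi * θ) n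
  rw [← hc'] at hsq
  exact ⟨fun h => (hN n hn c).1 (by linarith), fun h => (hN n hn c).2 (by linarith)⟩
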